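/- Let $K$ be an arbitrary field, $N\ge n\ge 0$ integers, $R=K[x_0,\dots,x_N]$, and let $R_m$ be the space of homogeneous polynomials of degree $m$ in $R$. Let $X=V(f_1,\dots,f_{N-n})\subseteq\mathbb P^N_K$ be the projective subvariety defined by homogeneous polynomials $f_1,\dots,f_{N-n}\in R$ that form a regular sequence (so $\dim X=n$). Let $1\le s\le n+1$ and let $m_1,\dots,m_s$ be positive integers. In the affine space $\prod_{i=1}^s R_{m_i}\simeq\mathbb A_K^{\sum_i\binom{N+m_i}{N}}$, let $$\mathcal U_X(m_1,\dots,m_s)=\Bigl\{(h_1,\dots,h_s)\in\prod_{i=1}^sR_{m_i}:\ \dim\bigl(X\cap V(h_1,\dots,h_s)\bigr)\ge n-s+1\Bigr\},$$ understood as a locus in the affine space over $K$: it consists of all (scheme-theoretic) points $p$ of the affine space such that the corresponding tuple of polynomials over the residue field $\kappa(p)$ satisfies this inequality in $\mathbb P^N_{\kappa(p)}$. Here $\dim$ is the Krull dimension of a topological space, and the empty set has dimension $-\infty$. Then $$\dim\mathcal U_X(m_1,\dots,m_s)\le\sum_{i=1}^s\binom{N+m_i}{N}-\min_{1\le i\le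 s}\binom{n-i+1+m_i}{m_i}.$$ In particular, if $m_1=\dots=m_s=m$, then $$\dim\mathcal U_X(m,\dots,m)\le s\binom{N+m}{N}-\binom{n-s+1+m}{m}.$$ -/

import Mathlib

attribute [local instance] MvPolynomial.gradedAlgebra

/-- The dimension of the closed subset `V(F)` of the projective space `ℙ^N` over the field `L`
cut out by a set `F` of homogeneous polynomials in `x_0, …, x_N`: the Krull dimension of the closed
subset `V(F)` of `Proj L[x_0, …, x_N]` (so it is `⊥` if `V(F)` is empty). -/
noncomputable def projDim {L : Type*} [Field L] {N : ℕ}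
    (F : Set (MvPolynomial (Fin (N + 1)) L)) : WithBot ℕ∞ :=
  topologicalKrullDim
    (ProjectiveSpectrum.zeroLocus (MvPolynomial.homogeneousSubmodule (Fin (N + 1)) L) F)

/-- For `X = V(f_1, …, f_r) ⊆ ℙ^N` over the field `L`, the set of all tuples `(h_1, …, h_s)`
of homogeneous polynomials of degrees `m_1, …, m_s` with coefficients in `L` such that
`dim (X ∩ V(h_1, …, h_s)) ≥ n - s + 1`. The inequality is written without subtraction. -/
def nonRegularTuples {L : Type*} [Field L] {N r s : ℕ} (n : ℕ)
    (f : Fin r → MvPolynomial (Fin (N + 1)) L) (m : Fin s → ℕ) :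
    Set (Fin s → MvPolynomial (Fin (N + 1)) L) :=
  {h | (∀ i, (h i).IsHomogeneous (m i)) ∧
    (n : WithBot ℕ∞) + 1 ≤ projDim (Set.range f ∪ Set.range h) + (s : WithBot ℕ∞)}

/-- The exponent vectors of the monomials of degree `m` in `x_0, …, x_N`. -/
abbrev DegreeExponent (N m : ℕ) : Type :=
  {e : Fin (N + 1) →₀ ℕ // e ∈ Finset.finsuppAntidiag (Finset.univ : Finset (Fin (N + 1))) m}

/-- The coordinates on the affine space `∏ i, R_{m_i}`: one coordinate for the coefficient of every
monomial of degree `m_i` of the `i`-th polynomial. -/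
abbrev CoeffIndex (N : ℕ) {s : ℕ} (m : Fin s → ℕ) : Type :=
  Σ i : Fin s, DegreeExponent N (m i)

/-- The affine space `∏ i, R_{m_i}` over `K`, as the spectrum of its coordinate ring. -/
abbrev TupleSpace (K : Type*) [Field K] (N : ℕ) {s : ℕ} (m : Fin s → ℕ) : Type _ :=
  PrimeSpectrum (MvPolynomial (CoeffIndex N m) K)

/-- The tuple of homogeneous polynomials, with coefficients in the residue field, that corresponds
to a point of the affine space `∏ i, R_{m_i}`: the coefficient of the monomial `x ^ e` in the `i`-th
polynomial is the value at `p` of the coordinate function `(i, e)`. -/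
noncomputable def tupleAt {K : Type*} [Field K] {N s : ℕ} (m : Fin s → ℕ)
    (p : TupleSpace K N m) (i : Fin s) :
    MvPolynomial (Fin (N + 1)) p.asIdeal.ResidueField :=
  ∑ e : DegreeExponent N (m i),
    MvPolynomial.monomial e.1
      (algebraMap (MvPolynomial (CoeffIndex N m) K) p.asIdeal.ResidueField
        (MvPolynomial.X ⟨i, e⟩))

theorem tupleAt_isHomogeneous {K : Type*} [Field K] {N s : ℕ} (m : Fin s → ℕ)
    (p : TupleSpace K N m) (i : Fin s) : (tupleAt m p i).IsHomogeneous (m i) := by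
  refine MvPolynomial.IsHomogeneous.sum _ _ _ fun e _ => ?_
  apply MvPolynomial.isHomogeneous_monomial
  have h := (Finset.mem_finsuppAntidiag.1 e.2).1
  rw [Finsupp.degree_eq_sum]
  exact h

/-- The variety `𝒰_X(m_1, …, m_s)` over `K`, for `X = V(f_1, …, f_r) ⊆ ℙ^N`: the locus in the
affine space `∏ i, R_{m_i}` over `K` of all points `p` (not only the `K`-rational ones) whose tuple
`(h_1, …, h_s)` of polynomials over the residue field of `p` satisfies
`dim (X ∩ V(h_1, …, h_s)) ≥ n - s + 1`, where `X` is regarded over the residue field. -/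
def nonRegularVariety {K : Type*} [Field K] {N r s : ℕ} (n : ℕ)
    (f : Fin r → MvPolynomial (Fin (N + 1)) K) (m : Fin s → ℕ) : Set (TupleSpace K N m) :=
  {p | tupleAt m p ∈ nonRegularTuples n
    (fun j => MvPolynomial.map (algebraMap K p.asIdeal.ResidueField) (f j)) m}

/-!
A point `p` of the affine space of tuples is a prime of the polynomial ring in the coefficients, so
the dimension of its closure is the transcendence degree over `K` of the quotient by `p`, and the
task is to bound this transcendence degree for `p` in the locus, and to see that the generic point
of an irreducible subset of the locus may be used.

Dimensions of projective loci are measured by independent sets of variables: a set `S` of variables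
is independent modulo an ideal `I` of `L[x_0, …, x_N]` if `I` contains no nonzero polynomial in the
variables of `S`. If `dim V(F) ≥ e`, then some set of `e + 1` variables is independent modulo `(F)`
(`exists_isIndependentSet_of_le_projDim`), and modulo a regular sequence of length `r` an independent
set has at most `N + 1 - r` elements (`card_add_le_of_isRegular`). Both follow from the fact that the
transcendence degree of the quotient drops strictly along strict inclusions of primes
(`trdeg_quotient_lt_of_lt`).

Let the `h_i` be the tuple at `p`, and suppose that `n + 2 - s` variables are independent modulo
`(f, h_1, …, h_s)`. Choose the least `i` for which some set `S` of `n + 2 - i` variables is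
independent modulo `(f, h_1, …, h_i)`; then `i ≥ 1`, and no `S ∪ {j}` is independent modulo
`(f, h_1, …, h_{i-1})`. Take a prime `P` above `(f, h_1, …, h_i)` modulo which `S` is still
independent, and let `k` be the field generated over `K` by all coefficients except those of `h_i` at
monomials in the variables of `S`. Modulo `P`, every variable is algebraic over `k(x_S)`. The equation
`h_i = 0` shows that the part of `h_i` in the variables of `S` is algebraic over `k(x_S)`, and since
`x_S` is algebraically independent over the residue field of `p`, its coefficients are algebraic over
`k` (`isAlgebraic_coeff_of_isIndependentSet`). Hence the transcendence degree is at most the number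
of all coefficients minus the number `(n + 1 - i + m_i).choose m_i` of monomials of degree `m_i` in
the variables of `S` (`trdeg_add_choose_le_of_minimal`).

Finally, if `S` is dependent at a point `η`, a polynomial that witnesses this can be chosen with
coefficients in the coordinate ring, and it still witnesses the dependence on a nonempty open subset
of the closure of `η` (`Ideal.exists_notMem_forall_not_isIndependentSet`). So the generic point of an
irreducible subset of the enlarged locus `{p | some S is independent at p}` lies in this locus, and
the bound on transcendence degrees bounds its dimension
(`PrimeSpectrum.topologicalKrullDim_le_of_trdeg_le`).
-/

section

open MvPolynomial

/-! ### Transcendence degree and primes -/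

/-- A transcendence basis of `B` lifts to an algebraically independent family of `A`. If the
transcendence degrees were equal, it would be a transcendence basis of `A`, and the kernel would
meet the polynomial ring that it generates. -/
theorem trdeg_lt_of_surjective_of_not_injective {K A B : Type*} [Field K] [CommRing A] [IsDomain A]
    [CommRing B] [IsDomain B] [Algebra K A] [Algebra K B] [Algebra.FiniteType K A]
    (φ : A →ₐ[K] B) (hs : Function.Surjective φ) {a : A} (ha : a ≠ 0) (hφ : φ a = 0) :
    (Algebra.trdeg K B).toNat < (Algebra.trdeg K A).toNat := by
  have finA : Algebra.trdeg K A < Cardinal.aleph0 := trdeg_lt_aleph0_of_finiteType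
  have : Algebra.FiniteType K B := .of_surjective φ hs
  have finB : Algebra.trdeg K B < Cardinal.aleph0 := trdeg_lt_aleph0_of_finiteType
  obtain ⟨ι, y, hy⟩ := exists_isTranscendenceBasis' K B
  choose x hx using fun i => hs (y i)
  obtain rfl : φ ∘ x = y := funext hx
  have hxi : AlgebraicIndependent K x := AlgebraicIndependent.of_comp φ hy.1
  by_contra hlt
  rw [not_lt] at hlt
  have hcard := hy.lift_cardinalMk_eq_trdeg
  have hιfin : Finite ι := by
    rw [← Cardinal.mk_lt_aleph0_iff, ← Cardinal.lift_lt_aleph0, hcard, Cardinal.lift_lt_aleph0]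
    exact finB
  have hb : IsTranscendenceBasis K x := by
    refine hxi.isTranscendenceBasis_of_lift_trdeg_le finA ?_
    have h1 : (Cardinal.mk ι).toNat = (Algebra.trdeg K B).toNat := by
      simpa using congrArg Cardinal.toNat hcard
    rw [← Cardinal.cast_toNat_of_lt_aleph0 finA, ← Cardinal.cast_toNat_of_lt_aleph0
      (Cardinal.mk_lt_aleph0_iff.2 hιfin), h1]
    simpa using hlt
  -- A nonzero multiple `b` of `a` lies in `K[x]`; it maps to zero, although `φ` is injective there.
  have halg := hb.isAlgebraic
  obtain ⟨b, hb0, c, hc⟩ := (halg.isAlgebraic a).exists_nonzero_dvd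
    (mem_nonZeroDivisors_of_ne_zero ha)
  obtain ⟨p, hp⟩ : ∃ p, aeval x p = (b : A) := by
    exact (AlgHom.mem_range _).1 ((Algebra.adjoin_range_eq_range_aeval K x).le b.2)
  have h0 : φ (b : A) = 0 := by
    have : (b : A) = a * c := hc
    rw [this, map_mul, hφ, zero_mul]
  apply hb0
  have : p = 0 := by
    apply (algebraicIndependent_iff.1 hy.1)
    rw [← hp] at h0
    rw [← h0]
    exact (MvPolynomial.comp_aeval_apply (f := x) φ p).symm
  apply Subtype.ext
  rw [← hp, this]; simp

theorem trdeg_quotient_lt_of_lt {K A : Type*} [Field K] [CommRing A] [Algebra K A]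
    [Algebra.FiniteType K A] {P Q : Ideal A} [P.IsPrime] [Q.IsPrime] (h : P < Q) :
    (Algebra.trdeg K (A ⧸ Q)).toNat < (Algebra.trdeg K (A ⧸ P)).toNat := by
  obtain ⟨hle, a, haQ, haP⟩ := SetLike.lt_iff_le_and_exists.1 h
  refine trdeg_lt_of_surjective_of_not_injective (Ideal.Quotient.factorₐ K hle)
    (Ideal.Quotient.factor_surjective hle) (a := Ideal.Quotient.mk P a) ?_ ?_
  · rwa [Ne, Ideal.Quotient.eq_zero_iff_mem]
  · rw [Ideal.Quotient.factorₐ_apply_mk]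
    exact Ideal.Quotient.eq_zero_iff_mem.2 haQ

/-! ### Independent sets of variables -/

/-- A set `S` of variables is independent modulo the ideal `I` if `I` contains no nonzero
polynomial in the variables of `S` only. -/
def Ideal.IsIndependentSet {σ L : Type*} [CommSemiring L] (I : Ideal (MvPolynomial σ L))
    (S : Set σ) : Prop :=
  ∀ g ∈ I, g ∈ supported L S → g = 0

theorem Ideal.IsIndependentSet.mono {σ L : Type*} [CommSemiring L] {I J : Ideal (MvPolynomial σ L)}
    {S : Set σ} (hIJ : I ≤ J) (h : J.IsIndependentSet S) : I.IsIndependentSet S :=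
  fun g hg hS => h g (hIJ hg) hS

/-- The nonzero polynomials in the variables of `S` form a multiplicative set disjoint from `I`. -/
theorem Ideal.IsIndependentSet.exists_isPrime {σ L : Type*} [Field L]
    {I : Ideal (MvPolynomial σ L)} {S : Set σ} (h : I.IsIndependentSet S) :
    ∃ P : Ideal (MvPolynomial σ L), P.IsPrime ∧ I ≤ P ∧ P.IsIndependentSet S := by
  let M : Submonoid (MvPolynomial σ L) :=
    (nonZeroDivisors (supported L S)).map (supported L S).val
  have hd : Disjoint (I : Set (MvPolynomial σ L)) M := by
    rw [Set.disjoint_left]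
    rintro _ hg ⟨g, hg0, rfl⟩
    have := h _ hg g.2
    exact nonZeroDivisors.ne_zero hg0 (Subtype.ext this)
  obtain ⟨P, hP, hIP, hPM⟩ := Ideal.exists_le_prime_disjoint _ _ hd
  refine ⟨P, hP, hIP, fun g hg hS => ?_⟩
  by_contra hg0
  refine Set.disjoint_left.1 hPM hg ⟨⟨g, hS⟩, ?_, rfl⟩
  exact mem_nonZeroDivisors_of_ne_zero fun h => hg0 (congrArg Subtype.val h)

theorem Ideal.isIndependentSet_iff_algebraicIndependent {σ L : Type*} [Field L]
    (I : Ideal (MvPolynomial σ L)) (S : Set σ) :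
    I.IsIndependentSet S ↔
      AlgebraicIndependent L (fun i : S => Ideal.Quotient.mk I (X i.1)) := by
  have key (p : MvPolynomial S L) : aeval (fun i : S => Ideal.Quotient.mk I (X i.1)) p =
      Ideal.Quotient.mk I (rename (↑) p) := by
    have : aeval (R := L) (fun i : S => Ideal.Quotient.mk I (X i.1)) =
        (Ideal.Quotient.mkₐ L I).comp (rename (↑)) := by
      ext i; simp
    rw [this]; rfl
  rw [algebraicIndependent_iff]
  constructor
  · intro h p hp
    rw [key, Ideal.Quotient.eq_zero_iff_mem] at hp
    have := h _ hp (by rw [supported_eq_range_rename]; exact ⟨p, rfl⟩)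
    exact (rename_injective _ Subtype.val_injective) (by rw [this, map_zero])
  · intro h g hg hS
    rw [supported_eq_range_rename] at hS
    obtain ⟨p, rfl⟩ := hS
    have := h p (by rw [key]; exact Ideal.Quotient.eq_zero_iff_mem.2 hg)
    rw [this]; simp

theorem Ideal.IsIndependentSet.card_le_trdeg {σ L : Type*} [Finite σ] [Field L]
    {I : Ideal (MvPolynomial σ L)} [I.IsPrime] {S : Finset σ} (h : I.IsIndependentSet (S : Set σ)) :
    S.card ≤ (Algebra.trdeg L (MvPolynomial σ L ⧸ I)).toNat := by
  have h1 := ((I.isIndependentSet_iff_algebraicIndependent _).1 h).lift_cardinalMk_le_trdeg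
  have fin : Algebra.trdeg L (MvPolynomial σ L ⧸ I) < Cardinal.aleph0 :=
    trdeg_lt_aleph0_of_finiteType
  rw [← Cardinal.cast_toNat_of_lt_aleph0 fin] at h1
  simpa using h1

/-- A transcendence basis of the quotient can be chosen among the classes of the variables. -/
theorem Ideal.exists_isIndependentSet_of_le_trdeg {σ L : Type*} [Finite σ] [Field L]
    (P : Ideal (MvPolynomial σ L)) [P.IsPrime] {e : ℕ}
    (he : e ≤ (Algebra.trdeg L (MvPolynomial σ L ⧸ P)).toNat) :
    ∃ S : Finset σ, S.card = e ∧ P.IsIndependentSet (S : Set σ) := by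
  classical
  let y : σ → MvPolynomial σ L ⧸ P := fun i => Ideal.Quotient.mk P (X i)
  have hgen : Algebra.adjoin L (Set.range y) = ⊤ := by
    have : Set.range y = Ideal.Quotient.mkₐ L P '' Set.range X := by
      rw [← Set.range_comp]; rfl
    rw [this, Algebra.adjoin_image, MvPolynomial.adjoin_range_X, Algebra.map_top,
      AlgHom.range_eq_top]
    exact Ideal.Quotient.mk_surjective
  have halg : Algebra.IsAlgebraic (Algebra.adjoin L (Set.range y)) (MvPolynomial σ L ⧸ P) := by
    rw [hgen]
    exact ⟨fun a => isAlgebraic_algebraMap (⟨a, trivial⟩ : (⊤ : Subalgebra L _))⟩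
  obtain ⟨t, ht, hbt⟩ := exists_isTranscendenceBasis_subset (R := L) (Set.range y)
  have hcard := hbt.lift_cardinalMk_eq_trdeg
  have hfin : t.Finite := (Set.finite_range y).subset ht
  have hcard' : t.ncard = (Algebra.trdeg L (MvPolynomial σ L ⧸ P)).toNat := by
    rw [← Nat.card_coe_set_eq, Nat.card]
    simpa using congrArg Cardinal.toNat hcard
  rw [← hcard'] at he
  obtain ⟨u, hut, hu⟩ := Set.exists_subset_card_eq he
  have hufin : u.Finite := hfin.subset hut
  choose g hg using fun z : u => ht (hut z.2)
  have hginj : Function.Injective g := fun a b hab => Subtype.ext (by rw [← hg a, ← hg b, hab])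
  have := hufin.fintype
  refine ⟨Finset.univ.image g, ?_, ?_⟩
  · rw [Finset.card_image_of_injective _ hginj, Finset.card_univ, ← Nat.card_eq_fintype_card,
      Nat.card_coe_set_eq, hu]
  · rw [Ideal.isIndependentSet_iff_algebraicIndependent]
    have hind : AlgebraicIndependent L ((↑) : t → MvPolynomial σ L ⧸ P) := hbt.1
    have hex (i : ((Finset.univ.image g : Finset σ) : Set σ)) : ∃ z : u, g z = i.1 := by
      simpa using i.2
    choose w hw using hex
    have heq : (fun i : ((Finset.univ.image g : Finset σ) : Set σ) =>
        Ideal.Quotient.mk P (X i.1)) = ((↑) : t → _) ∘ fun i => ⟨(w i).1, hut (w i).2⟩ := by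
      funext i
      change _ = (w i).1
      rw [← hg (w i), hw]
    rw [heq]
    refine hind.comp _ fun a b hab => ?_
    have : w a = w b := Subtype.ext (by simpa using hab)
    exact Subtype.ext (by rw [← hw a, ← hw b, this])

/-! ### Coefficients of algebraic polynomials and descent of independence -/

section
attribute [local instance] MvPolynomial.algebraMvPolynomial

/-- An element of `L[x]` that is algebraic over `k[x]` has a multiple by a nonzero element of `k[x]`
that is integral, hence has coefficients integral over `k`. Comparing leading coefficients shows
that the leading coefficient is algebraic over `k`. This is applied to the part with transcendental
coefficients, which is again algebraic over `k[x]` and must therefore vanish. -/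
theorem isAlgebraic_coeff_of_isAlgebraic {k L σ : Type*} [Field k] [Field L] [Algebra k L]
    [Finite σ] {g : MvPolynomial σ L} (hg : IsAlgebraic (MvPolynomial σ k) g) (α : σ →₀ ℕ) :
    IsAlgebraic k (coeff α g) := by
  classical
  let : LinearOrder σ := IsWellOrder.linearOrder WellOrderingRel
  let o : MonomialOrder σ := MonomialOrder.lex
  have lead (q : MvPolynomial σ L) (hq : IsAlgebraic (MvPolynomial σ k) q) :
      IsAlgebraic k (o.leadingCoeff q) := by
    obtain ⟨a, ha, hint⟩ := hq.exists_integral_multiple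
    have ha' : (algebraMap (MvPolynomial σ k) (MvPolynomial σ L) a) ≠ 0 := by
      rw [MvPolynomial.algebraMap_def]
      exact (map_ne_zero_iff _ (map_injective _ (algebraMap k L).injective)).2 ha
    rw [Algebra.smul_def, MvPolynomial.isIntegral_iff_isIntegral_coeff] at hint
    have h1 : IsAlgebraic k (o.leadingCoeff (algebraMap (MvPolynomial σ k) (MvPolynomial σ L) a) *
        o.leadingCoeff q) := by
      rw [← MonomialOrder.leadingCoeff_mul]
      exact (hint _).isAlgebraic
    have h2 : IsAlgebraic k
        (o.leadingCoeff (algebraMap (MvPolynomial σ k) (MvPolynomial σ L) a)) := by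
      rw [MonomialOrder.leadingCoeff, MvPolynomial.algebraMap_def, coeff_map]
      exact isAlgebraic_algebraMap _
    have h3 := h2.inv.mul h1
    rwa [inv_mul_cancel_left₀ (o.leadingCoeff_ne_zero_iff.2 ha')] at h3
  -- `q` collects the terms of `g` with coefficients transcendental over `k`.
  let q : MvPolynomial σ L :=
    ∑ β ∈ g.support with ¬ IsAlgebraic k (coeff β g), monomial β (coeff β g)
  have hqc (β : σ →₀ ℕ) : coeff β q = if IsAlgebraic k (coeff β g) then 0 else coeff β g := by
    simp only [q, coeff_sum, coeff_monomial, Finset.sum_ite_eq', Finset.mem_filter, mem_support_iff]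
    by_cases h : coeff β g = 0 <;> by_cases h' : IsAlgebraic k (coeff β g) <;> simp_all
  have hq : IsAlgebraic (MvPolynomial σ k) q := by
    have : IsAlgebraic (MvPolynomial σ k) (g - q) := by
      refine (MvPolynomial.isIntegral_iff_isIntegral_coeff.2 fun β => ?_).isAlgebraic
      rw [coeff_sub, hqc]
      split_ifs with h
      · rw [sub_zero]
        exact h.isIntegral
      · rw [sub_self]
        exact isIntegral_zero
    simpa using hg.sub this
  by_contra hα
  have hq0 : q ≠ 0 := fun h => by
    have := hqc α
    rw [if_neg hα, h, coeff_zero] at this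
    exact hα (this ▸ isAlgebraic_zero)
  have h1 := lead q hq
  have h2 := o.leadingCoeff_ne_zero_iff.2 hq0
  rw [MonomialOrder.leadingCoeff, hqc] at h1 h2
  split_ifs at h1 h2 with h
  · exact h2 rfl
  · exact h h1
end

/-- The additive map `L[x] → k[x]` that applies a `k`-linear functional `L → k` to each coefficient. -/
noncomputable def MvPolynomial.mapDual {k L : Type*} (σ : Type*) [CommSemiring k] [CommSemiring L]
    [Algebra k L] (φ : Module.Dual k L) : MvPolynomial σ L →+ MvPolynomial σ k where
  toFun p := ∑ α ∈ p.support, monomial α (φ (coeff α p))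
  map_zero' := by simp
  map_add' p q := by
    classical
    have key (p : MvPolynomial σ L) (β : σ →₀ ℕ) :
        coeff β (∑ α ∈ p.support, monomial α (φ (coeff α p))) = φ (coeff β p) := by
      simp only [coeff_sum, coeff_monomial, Finset.sum_ite_eq', mem_support_iff]
      split_ifs with h
      · rfl
      · rw [not_not.1 h, map_zero]
    ext β
    rw [coeff_add, key, key, key, coeff_add, map_add]

theorem MvPolynomial.coeff_mapDual {k L σ : Type*} [CommSemiring k] [CommSemiring L]
    [Algebra k L] (φ : Module.Dual k L) (p : MvPolynomial σ L) (β : σ →₀ ℕ) :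
    coeff β (mapDual σ φ p) = φ (coeff β p) := by
  classical
  change coeff β (∑ α ∈ p.support, monomial α (φ (coeff α p))) = _
  simp only [coeff_sum, coeff_monomial, Finset.sum_ite_eq', mem_support_iff]
  split_ifs with h
  · rfl
  · rw [not_not.1 h, map_zero]

theorem MvPolynomial.mapDual_mul_map {k L σ : Type*} [CommSemiring k] [CommSemiring L]
    [Algebra k L] (φ : Module.Dual k L) (a : MvPolynomial σ L) (f : MvPolynomial σ k) :
    mapDual σ φ (a * map (algebraMap k L) f) = mapDual σ φ a * f := by
  classical
  ext β
  simp only [coeff_mapDual, coeff_mul, map_sum, coeff_map]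
  refine Finset.sum_congr rfl fun x _ => ?_
  rw [mul_comm, ← Algebra.smul_def, map_smul, smul_eq_mul, mul_comm]

theorem MvPolynomial.mem_supported_iff_coeff {L σ : Type*} [CommSemiring L] {S : Set σ}
    {p : MvPolynomial σ L} :
    p ∈ supported L S ↔ ∀ α, ¬ (α.support : Set σ) ⊆ S → coeff α p = 0 := by
  rw [mem_supported]
  constructor
  · intro h α hα
    by_contra hc
    exact hα fun i hi => h ((mem_vars_iff_mem_support _).2 ⟨α, mem_support_iff.2 hc, hi⟩)
  · intro h i hi
    obtain ⟨α, hα, hi⟩ := (mem_vars_iff_mem_support _).1 hi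
    by_contra hiS
    exact mem_support_iff.1 hα (h α fun hsub => hiS (hsub hi))

/-- Independence is invariant under field extension. For descent, a `k`-linear functional `L → k`
that is applied to coefficients maps the extension of `I` into `I` and preserves the variables that
occur. -/
theorem Ideal.isIndependentSet_map_iff {k σ : Type*} (L : Type*) [Field k] [Field L]
    [Algebra k L] (I : Ideal (MvPolynomial σ k)) (S : Set σ) :
    (I.map (MvPolynomial.map (algebraMap k L))).IsIndependentSet S ↔ I.IsIndependentSet S := by
  constructor
  · intro h g hg hS
    have := h _ (Ideal.mem_map_of_mem _ hg) (mem_supported_iff_coeff.2 fun α hα => by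
      rw [coeff_map, mem_supported_iff_coeff.1 hS α hα, map_zero])
    exact map_injective _ (algebraMap k L).injective (by rw [this, map_zero])
  · intro h g hg hS
    ext α
    rw [coeff_zero]
    refine (Module.forall_dual_apply_eq_zero_iff k _).1 fun φ => ?_
    have hmem : mapDual σ φ g ∈ I := by
      suffices ∀ b, mapDual σ φ (b * g) ∈ I by simpa using this 1
      refine Submodule.span_induction (p := fun g _ => ∀ b, mapDual σ φ (b * g) ∈ I) ?_ ?_ ?_ ?_ hg
      · rintro _ ⟨f, hf, rfl⟩ b
        rw [mapDual_mul_map]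
        exact I.mul_mem_left _ hf
      · simp
      · intro x y _ _ hx hy b
        rw [mul_add, map_add]
        exact I.add_mem (hx b) (hy b)
      · intro a x _ hx b
        rw [smul_eq_mul, ← mul_assoc]
        exact hx _
    have := h _ hmem (mem_supported_iff_coeff.2 fun β hβ => by
      rw [coeff_mapDual, mem_supported_iff_coeff.1 hS β hβ, map_zero])
    rw [← coeff_mapDual, this, coeff_zero]

/-! ### Algebraic dependence of coefficients -/

/-- Let `S` be independent modulo the ideal generated by `I` and `h₀ + g`, where `I` and `h₀` are
defined over `k` and `g` involves only the variables of `S`, while no set `S ∪ {j}` is independent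
modulo `I`. Then the coefficients of `g` are algebraic over `k`: modulo a suitable prime, all
variables are algebraic over `k(x_S)`, hence so is `g = -h₀`, and `x_S` is algebraically independent
over `L`. -/
theorem isAlgebraic_coeff_of_isIndependentSet {k L σ : Type*} [Field k] [Field L] [Algebra k L]
    [Finite σ] {I : Ideal (MvPolynomial σ k)} {S : Set σ} {h₀ : MvPolynomial σ k}
    {g : MvPolynomial σ L} (hg : g ∈ supported L S)
    (hS : (I.map (MvPolynomial.map (algebraMap k L)) ⊔
      Ideal.span {MvPolynomial.map (algebraMap k L) h₀ + g}).IsIndependentSet S)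
    (hdep : ∀ j ∉ S, ¬ I.IsIndependentSet (insert j S)) (α : σ →₀ ℕ) :
    IsAlgebraic k (coeff α g) := by
  obtain ⟨P, hP, hle, hPS⟩ := hS.exists_isPrime
  let y : σ → MvPolynomial σ L ⧸ P := fun i => Ideal.Quotient.mk P (X i)
  have hyL : AlgebraicIndependent L (fun i : S => y i) :=
    (P.isIndependentSet_iff_algebraicIndependent S).1 hPS
  have hyk : AlgebraicIndependent k (fun i : S => y i) :=
    hyL.restrictScalars (algebraMap k L).injective
  have hmk (p : MvPolynomial σ k) :
      aeval y p = Ideal.Quotient.mk P (MvPolynomial.map (algebraMap k L) p) := by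
    induction p using MvPolynomial.induction_on with
    | C a =>
      rw [map_C, algHom_C]
      rfl
    | add p q hp hq => rw [map_add, hp, hq, map_add, map_add]
    | mul_X p i hp => rw [map_mul, hp, map_mul, map_mul, aeval_X, map_X]
  -- `D = k[x_S]` inside the quotient by `P`.
  let D := Algebra.adjoin k (y '' S)
  have halg (j : σ) : IsAlgebraic D (y j) := by
    by_cases hj : j ∈ S
    · exact isAlgebraic_algebraMap (⟨y j, Algebra.subset_adjoin ⟨j, hj, rfl⟩⟩ : D)
    · by_contra htr
      have hind := (AlgebraicIndepOn.insert_iff (R := k) (x := y) hj).2 ⟨hyk, htr⟩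
      refine hdep j hj fun p hp hpS => ?_
      rw [supported_eq_range_rename] at hpS
      obtain ⟨p, rfl⟩ := hpS
      change rename _ p ∈ I at hp
      have h0 : aeval (fun i : (insert j S : Set σ) => y i) p = 0 := by
        have := hmk (rename Subtype.val p)
        rw [Ideal.Quotient.eq_zero_iff_mem.2
          (hle (Ideal.mem_sup_left (Ideal.mem_map_of_mem _ hp)))] at this
        rw [← this]
        exact (aeval_rename Subtype.val y p).symm
      have h1 := algebraicIndependent_iff.1 hind p h0
      change rename _ p = 0
      rw [h1, map_zero]
  have halg' (p : MvPolynomial σ k) : IsAlgebraic D (aeval y p) := by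
    induction p using MvPolynomial.induction_on with
    | C a =>
      rw [algHom_C, IsScalarTower.algebraMap_apply k D]
      exact isAlgebraic_algebraMap _
    | add p q hp hq =>
      rw [map_add]
      exact hp.add hq
    | mul_X p i hp =>
      rw [map_mul, aeval_X]
      exact hp.mul (halg i)
  obtain ⟨g, rfl⟩ : ∃ g' : MvPolynomial S L, rename (↑) g' = g := by
    rw [supported_eq_range_rename] at hg
    exact hg
  have hgy : aeval (fun i : S => y i) g = - aeval y h₀ := by
    have h1 : aeval (fun i : S => y i) g = Ideal.Quotient.mk P (rename (↑) g) := by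
      have : aeval (R := L) (fun i : S => y i) =
        (Ideal.Quotient.mkₐ L P).comp (rename (↑)) := by
        ext i; simp [y]
      rw [this]; rfl
    rw [h1, hmk, eq_neg_iff_add_eq_zero, ← map_add, Ideal.Quotient.eq_zero_iff_mem, add_comm]
    exact hle (Ideal.mem_sup_right (Ideal.mem_span_singleton_self _))
  have hgD : IsAlgebraic D (aeval (R := L) (fun i : S => y i) g) := hgy ▸ (halg' h₀).neg
  have hgalg : @IsAlgebraic (MvPolynomial S k) (MvPolynomial S L) _ _
      (MvPolynomial.algebraMvPolynomial) g := by
    let := MvPolynomial.algebraMvPolynomial (R := k) (S := L) (σ := S)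
    have hrange (p : MvPolynomial S k) : aeval (fun i : S => y i) p ∈ D := by
      have : y '' S = Set.range fun i : S => y i := Set.image_eq_range _ _
      simp only [D, this, Algebra.adjoin_range_eq_range_aeval]
      exact ⟨p, rfl⟩
    refine hgD.of_ringHom_of_comp_eq
      ((aeval (fun i : S => y i)).codRestrict D hrange : MvPolynomial S k →ₐ[k] D)
      (aeval (R := L) (fun i : S => y i) : MvPolynomial S L →ₐ[L] _) ?_ hyL ?_
    · rintro ⟨z, hz⟩
      have : y '' S = Set.range fun i : S => y i := Set.image_eq_range _ _
      simp only [D, this, Algebra.adjoin_range_eq_range_aeval] at hz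
      obtain ⟨p, rfl⟩ := hz
      exact ⟨p, rfl⟩
    · ext p
      · simp
        rfl
      · simp
  by_cases hα : α ∈ (rename (↑) g : MvPolynomial σ L).support
  · classical
    rw [support_rename_of_injective Subtype.val_injective, Finset.mem_image] at hα
    obtain ⟨β, -, rfl⟩ := hα
    rw [coeff_rename_mapDomain _ Subtype.val_injective]
    exact isAlgebraic_coeff_of_isAlgebraic hgalg β
  · rw [notMem_support_iff.1 hα]
    exact isAlgebraic_zero


/-- If the residue field of `p` is algebraic over the subfield generated by the coordinates outside
`T`, then its transcendence degree is at most the number of these coordinates. -/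
theorem trdeg_quotient_add_card_le_of_isAlgebraic {K ι : Type*} [Field K] [Fintype ι]
    [DecidableEq ι] (p : Ideal (MvPolynomial ι K)) [p.IsPrime] (T : Finset ι)
    (h : ∀ i ∈ T, IsAlgebraic (IntermediateField.adjoin K
      ((fun i => algebraMap (MvPolynomial ι K) p.ResidueField (X i)) '' (Tᶜ : Finset ι)))
      (algebraMap (MvPolynomial ι K) p.ResidueField (X i))) :
    (Algebra.trdeg K (MvPolynomial ι K ⧸ p)).toNat + T.card ≤ Fintype.card ι := by
  set c : ι → p.ResidueField := fun i => algebraMap (MvPolynomial ι K) p.ResidueField (X i)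
  let D := Algebra.adjoin K (c '' (Tᶜ : Finset ι))
  have hD (i : ι) : IsAlgebraic D (c i) := by
    by_cases hi : i ∈ T
    · exact IntermediateField.isAlgebraic_adjoin_iff.1 (h i hi)
    · exact isAlgebraic_algebraMap
        (⟨c i, Algebra.subset_adjoin ⟨i, by simpa using hi, rfl⟩⟩ : D)
  have hA (a : MvPolynomial ι K) : IsAlgebraic D (algebraMap _ p.ResidueField a) := by
    induction a using MvPolynomial.induction_on with
    | C a =>
      rw [← MvPolynomial.algebraMap_eq, ← IsScalarTower.algebraMap_apply,
        IsScalarTower.algebraMap_apply K D]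
      exact isAlgebraic_algebraMap _
    | add p q hp hq =>
      rw [map_add]
      exact hp.add hq
    | mul_X p i hp =>
      rw [map_mul]
      exact hp.mul (hD i)
  have : Algebra.IsAlgebraic D p.ResidueField := by
    refine ⟨fun x => ?_⟩
    obtain ⟨a, b, -, rfl⟩ := IsFractionRing.div_surjective (A := MvPolynomial ι K ⧸ p) x
    obtain ⟨a, rfl⟩ := Ideal.Quotient.mk_surjective a
    obtain ⟨b, rfl⟩ := Ideal.Quotient.mk_surjective b
    rw [div_eq_mul_inv]
    exact (hA a).mul (hA b).inv
  have h1 : Algebra.trdeg K p.ResidueField ≤ Cardinal.mk (c '' (Tᶜ : Finset ι)) :=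
    Algebra.IsAlgebraic.trdeg_le_cardinalMk K (c '' (Tᶜ : Finset ι))
  have h2 : Algebra.trdeg K (MvPolynomial ι K ⧸ p) ≤ Algebra.trdeg K p.ResidueField :=
    trdeg_le_of_injective (IsScalarTower.toAlgHom K (MvPolynomial ι K ⧸ p) p.ResidueField)
      (IsFractionRing.injective _ _)
  have h3 := Cardinal.toNat_le_toNat (h2.trans h1)
    (Cardinal.mk_lt_aleph0_iff.2 (((Tᶜ : Finset ι).finite_toSet.image c)))
  have h4 : (c '' (Tᶜ : Finset ι)).ncard ≤ (Tᶜ : Finset ι).card := by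
    rw [← Set.ncard_coe_finset]
    exact Set.ncard_image_le (Finset.finite_toSet _)
  rw [← Nat.card_coe_set_eq] at h4
  have h5 := Finset.card_compl_add_card T
  have h6 := h3.trans h4
  omega

/-! ### Regular sequences and vanishing ideals -/

/-- Each member of a regular sequence lies outside the minimal primes of the ideal generated by the
preceding ones, so it lowers the transcendence degree by at least one. -/
theorem trdeg_quotient_add_le_of_isWeaklyRegular {σ L : Type*} [Fintype σ] [Field L]
    {rs : List (MvPolynomial σ L)}
    (hrs : RingTheory.Sequence.IsWeaklyRegular (MvPolynomial σ L) rs) (j : ℕ) (hj : j ≤ rs.length)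
    (P : Ideal (MvPolynomial σ L)) [hP : P.IsPrime] (hle : Ideal.ofList (rs.take j) ≤ P) :
    (Algebra.trdeg L (MvPolynomial σ L ⧸ P)).toNat + j ≤ Fintype.card σ := by
  induction j generalizing P with
  | zero =>
    have h1 := trdeg_le_of_surjective (Ideal.Quotient.mkₐ L P) Ideal.Quotient.mk_surjective
    have h2 := Cardinal.toNat_le_toNat h1 trdeg_lt_aleph0_of_finiteType
    simpa using h2
  | succ j ih =>
    have hjl : j < rs.length := hj
    have hsplit : Ideal.ofList (rs.take (j + 1)) =
        Ideal.ofList (rs.take j) ⊔ Ideal.span {rs[j]} := by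
      rw [List.take_succ_eq_append_getElem hjl, Ideal.ofList_append, Ideal.ofList_singleton]
    rw [hsplit] at hle
    obtain ⟨Q, hQ, hQP⟩ := Ideal.exists_minimalPrimes_le (le_sup_left.trans hle)
    have hQprime : Q.IsPrime := hQ.1.1
    have hxP : rs[j] ∈ P := hle (Ideal.mem_sup_right (Ideal.mem_span_singleton_self _))
    have hxQ : rs[j] ∉ Q := by
      intro hx
      obtain ⟨y, hy, hxy⟩ := Ideal.exists_mul_mem_of_mem_minimalPrimes hQ hx
      have hreg := hrs.regular_mod_prev j hjl
      have htop : (Ideal.ofList (rs.take j) • ⊤ : Submodule (MvPolynomial σ L) (MvPolynomial σ L)) =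
        Ideal.ofList (rs.take j) := by simp
      rw [htop] at hreg
      have h0 : rs[j] • (Submodule.Quotient.mk y : MvPolynomial σ L ⧸ Ideal.ofList (rs.take j)) =
          rs[j] • 0 := by
        rw [smul_zero, ← Submodule.Quotient.mk_smul, Submodule.Quotient.mk_eq_zero]
        exact hxy
      exact hy ((Submodule.Quotient.mk_eq_zero _).1 (hreg h0))
    have hlt : Q < P := lt_of_le_of_ne hQP fun h => hxQ (h ▸ hxP)
    have h1 := ih (by omega) Q hQ.1.2
    have h2 := trdeg_quotient_lt_of_lt (K := L) hlt
    omega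

theorem card_add_le_of_isRegular {σ L : Type*} [Fintype σ] [Field L] {r : ℕ}
    {f : Fin r → MvPolynomial σ L}
    (hf : RingTheory.Sequence.IsRegular (MvPolynomial σ L) (List.ofFn f)) {S : Finset σ}
    (hS : (Ideal.span (Set.range f)).IsIndependentSet (S : Set σ)) :
    S.card + r ≤ Fintype.card σ := by
  obtain ⟨P, hP, hle, hPS⟩ := hS.exists_isPrime
  have h1 := trdeg_quotient_add_le_of_isWeaklyRegular hf.toIsWeaklyRegular r (by simp) P (by
    rw [List.take_of_length_le (by simp)]
    refine le_trans (le_of_eq ?_) hle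
    simp [Ideal.ofList, Set.range, List.mem_ofFn])
  have h2 := hPS.card_le_trdeg
  omega

theorem ProjectiveSpectrum.isPrime_vanishingIdeal {A σ : Type*} [CommRing A] [SetLike σ A]
    [AddSubgroupClass σ A] (𝒜 : ℕ → σ) [GradedRing 𝒜] {Z : Set (ProjectiveSpectrum 𝒜)}
    (hZ : IsIrreducible Z) : (vanishingIdeal Z).toIdeal.IsPrime := by
  refine ⟨fun h => ?_, fun {a b} hab => ?_⟩
  · obtain ⟨z, hz⟩ := hZ.1
    have h1 : (1 : A) ∈ (vanishingIdeal Z).toIdeal := h ▸ Submodule.mem_top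
    exact z.isPrime.ne_top ((Ideal.eq_top_iff_one _).2 ((mem_vanishingIdeal _ _).1 h1 z hz))
  · have hab' : ∀ z ∈ Z, a * b ∈ z.asHomogeneousIdeal := (mem_vanishingIdeal _ _).1 hab
    have hsub : Z ⊆ zeroLocus 𝒜 {a} ∪ zeroLocus 𝒜 {b} := fun z hz => by
      rcases z.isPrime.mem_or_mem (hab' z hz) with h | h
      · exact Or.inl (by simpa using h)
      · exact Or.inr (by simpa using h)
    rcases (isPreirreducible_iff_isClosed_union_isClosed.1 hZ.2) _ _ (isClosed_zeroLocus _ _)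
      (isClosed_zeroLocus _ _) hsub with h | h
    · exact Or.inl ((mem_vanishingIdeal _ _).2 fun z hz => by simpa using h hz)
    · exact Or.inr ((mem_vanishingIdeal _ _).2 fun z hz => by simpa using h hz)

/-! ### Krull dimension of subsets of spectra -/

/-- The hypothesis `hU` says that the complement of `U` contains, with each point `η`, a
neighbourhood of `η` in its closure. Hence the generic point of the closure of an irreducible subset
of `U` lies in `U`, and closed irreducible subsets of `U` are separated by the transcendence degrees
at these points. -/
theorem PrimeSpectrum.topologicalKrullDim_le_of_trdeg_le {K A : Type*} [Field K] [CommRing A]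
    [Algebra K A] [Algebra.FiniteType K A] {U : Set (PrimeSpectrum A)}
    (hU : ∀ η ∉ U, ∃ a ∉ η.asIdeal, ∀ q ∈ U, η ≤ q → a ∈ q.asIdeal) {M : ℕ}
    (hM : ∀ p ∈ U, (Algebra.trdeg K (A ⧸ p.asIdeal)).toNat ≤ M) :
    topologicalKrullDim U ≤ M := by
  -- `I Z` is the generic point of the closure of `Z` in the spectrum.
  let I (Z : TopologicalSpace.IrreducibleCloseds U) : PrimeSpectrum A :=
    ⟨PrimeSpectrum.vanishingIdeal ((↑) '' (Z : Set U)),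
      PrimeSpectrum.isIrreducible_iff_vanishingIdeal_isPrime.1
        (Z.isIrreducible.image _ continuous_subtype_val.continuousOn)⟩
  have hle (Z : TopologicalSpace.IrreducibleCloseds U) (q : U) (hq : q ∈ Z) : I Z ≤ q :=
    fun a ha => (PrimeSpectrum.mem_vanishingIdeal _ _).1 ha _ ⟨q, hq, rfl⟩
  have hmem (Z : TopologicalSpace.IrreducibleCloseds U) : I Z ∈ U := by
    by_contra h
    obtain ⟨a, ha, hq⟩ := hU _ h
    refine ha ((PrimeSpectrum.mem_vanishingIdeal _ _).2 ?_)
    rintro _ ⟨q, hqZ, rfl⟩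
    exact hq q q.2 (hle Z q hqZ)
  have hZ (Z : TopologicalSpace.IrreducibleCloseds U) (q : U) : I Z ≤ q ↔ q ∈ Z := by
    refine ⟨fun h => ?_, hle Z q⟩
    have h1 : (q : PrimeSpectrum A) ∈ closure ((↑) '' (Z : Set U)) := by
      rw [← PrimeSpectrum.zeroLocus_vanishingIdeal_eq_closure]
      exact h
    have h2 : q ∈ closure (Z : Set U) := by
      rw [Topology.IsInducing.subtypeVal.closure_eq_preimage_closure_image]
      exact h1
    rwa [Z.isClosed.closure_eq] at h2
  have hlt (Z Z' : TopologicalSpace.IrreducibleCloseds U) (h : Z < Z') : I Z' < I Z := by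
    refine lt_of_le_not_ge ((hZ Z' ⟨I Z, hmem Z⟩).2 (h.le ((hZ Z ⟨I Z, hmem Z⟩).1 le_rfl)))
      fun hge => h.not_ge fun q hq => (hZ Z q).1 (hge.trans ((hZ Z' q).2 hq))
  let d (Z : TopologicalSpace.IrreducibleCloseds U) : Set.Iic M :=
    ⟨(Algebra.trdeg K (A ⧸ (I Z).asIdeal)).toNat, hM _ (hmem Z)⟩
  have hd : StrictMono d := fun Z Z' h => by
    have := (I Z).isPrime
    have := (I Z').isPrime
    exact trdeg_quotient_lt_of_lt (K := K) ((PrimeSpectrum.asIdeal_lt_asIdeal _ _).2 (hlt Z Z' h))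
  refine (Order.krullDim_le_of_strictMono d hd).trans ?_
  rw [← Order.height_eq_krullDim_Iic, Order.height_nat]
  rfl

/-! ### Projective dimension and independent sets -/

theorem MvPolynomial.proj_zero_eq_C_constantCoeff {σ L : Type*} [CommSemiring L]
    (a : MvPolynomial σ L) :
    (DirectSum.decompose (homogeneousSubmodule σ L) a 0 : MvPolynomial σ L) =
      C (constantCoeff a) :=
  (decomposition.decompose'_apply a 0).trans (homogeneousComponent_zero a)

theorem ProjectiveSpectrum.vanishingIdeal_lt_ker_constantCoeff {σ L : Type*} [Field L]
    {Z : Set (ProjectiveSpectrum (homogeneousSubmodule σ L))} (hZ : Z.Nonempty) :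
    (vanishingIdeal Z).toIdeal < RingHom.ker (constantCoeff (R := L) (σ := σ)) := by
  obtain ⟨z, hz⟩ := hZ
  have hle : (vanishingIdeal Z).toIdeal ≤ z.asHomogeneousIdeal.toIdeal :=
    fun a ha => (mem_vanishingIdeal _ _).1 ha z hz
  refine lt_of_le_not_ge (fun a ha => ?_) fun hge => z.not_irrelevant_le fun a ha => ?_
  · by_contra hc
    have h0 : C (constantCoeff a) ∈ (vanishingIdeal Z).toIdeal := by
      rw [← proj_zero_eq_C_constantCoeff]
      exact (vanishingIdeal Z).isHomogeneous 0 ha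
    exact z.isPrime.ne_top
      (Ideal.eq_top_of_isUnit_mem _ (hle h0) ((isUnit_iff_ne_zero.2 hc).map C))
  · refine hle (hge ?_)
    have h0 : C (constantCoeff a) = (0 : MvPolynomial σ L) := by
      rw [← proj_zero_eq_C_constantCoeff]
      exact (HomogeneousIdeal.mem_irrelevant_iff _ _).1 ha
    exact C_injective _ _ (h0.trans C_0.symm)

/-- A chain of irreducible closed subsets gives a chain of homogeneous primes, all strictly
contained in the ideal `(x_0, …, x_N)`; the latter accounts for the summand `1`. -/
theorem exists_isIndependentSet_of_le_projDim {L : Type*} [Field L] {N e : ℕ}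
    {F : Set (MvPolynomial (Fin (N + 1)) L)} (h : (e : WithBot ℕ∞) ≤ projDim F) :
    ∃ S : Finset (Fin (N + 1)), S.card = e + 1 ∧
      (Ideal.span F).IsIndependentSet (S : Set (Fin (N + 1))) := by
  obtain ⟨l, hl⟩ := Order.le_krullDim_iff.1 h
  let 𝒜 := homogeneousSubmodule (Fin (N + 1)) L
  let Y := ProjectiveSpectrum.zeroLocus 𝒜 F
  let I (Z : TopologicalSpace.IrreducibleCloseds Y) : Ideal (MvPolynomial (Fin (N + 1)) L) :=
    (ProjectiveSpectrum.vanishingIdeal ((↑) '' (Z : Set Y) : Set (ProjectiveSpectrum 𝒜))).toIdeal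
  have hI (Z : TopologicalSpace.IrreducibleCloseds Y) : (I Z).IsPrime :=
    ProjectiveSpectrum.isPrime_vanishingIdeal 𝒜
      (Z.isIrreducible.image _ continuous_subtype_val.continuousOn)
  have hle (Z : TopologicalSpace.IrreducibleCloseds Y) (q : Y) (hq : q ∈ Z) :
      I Z ≤ q.1.asHomogeneousIdeal.toIdeal :=
    fun a ha => (ProjectiveSpectrum.mem_vanishingIdeal _ _).1 ha _ ⟨q, hq, rfl⟩
  have hZ (Z : TopologicalSpace.IrreducibleCloseds Y) (q : Y)
      (h : I Z ≤ q.1.asHomogeneousIdeal.toIdeal) : q ∈ Z := by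
    have h1 : (q : ProjectiveSpectrum 𝒜) ∈ closure ((↑) '' (Z : Set Y)) := by
      rw [← ProjectiveSpectrum.zeroLocus_vanishingIdeal_eq_closure]
      exact h
    have h2 : q ∈ closure (Z : Set Y) := by
      rw [Topology.IsInducing.subtypeVal.closure_eq_preimage_closure_image]
      exact h1
    rwa [Z.isClosed.closure_eq] at h2
  have hlt (Z Z' : TopologicalSpace.IrreducibleCloseds Y) (h : Z < Z') : I Z' < I Z := by
    refine lt_of_le_not_ge (ProjectiveSpectrum.vanishingIdeal_anti_mono _ (Set.image_mono h.le))
      fun hge => h.not_ge fun q hq => hZ Z q (hge.trans (hle Z' q hq))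
  let d (Z : TopologicalSpace.IrreducibleCloseds Y) : ℕ :=
    (Algebra.trdeg L (MvPolynomial (Fin (N + 1)) L ⧸ I Z)).toNat
  have hd : StrictMono d := fun Z Z' h => trdeg_quotient_lt_of_lt (hlt Z Z' h)
  have hpos (Z : TopologicalSpace.IrreducibleCloseds Y) : 0 < d Z := by
    have hlt := ProjectiveSpectrum.vanishingIdeal_lt_ker_constantCoeff
      (Z.isIrreducible.1.image ((↑) : Y → ProjectiveSpectrum 𝒜))
    have hker : (RingHom.ker (constantCoeff (R := L) (σ := Fin (N + 1)))).IsPrime :=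
      RingHom.ker_isPrime _
    exact (Nat.zero_le _).trans_lt (trdeg_quotient_lt_of_lt (K := L) hlt)
  have h1 := (l.map d hd).head_add_length_le_nat
  have h2 : 0 < d l.head := hpos _
  have h3 : e + 1 ≤ d l.last := by
    rw [LTSeries.head_map, LTSeries.last_map] at h1
    change d l.head + l.length ≤ d l.last at h1
    omega
  have := hI l.last
  obtain ⟨S, hS, hind⟩ := (I l.last).exists_isIndependentSet_of_le_trdeg h3
  refine ⟨S, hS, hind.mono (Ideal.span_le.2 fun a ha => ?_)⟩
  refine (ProjectiveSpectrum.mem_vanishingIdeal _ _).2 ?_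
  rintro _ ⟨q, -, rfl⟩
  exact q.2 ha

/-! ### Specialization of dependent sets -/

/-- Clearing denominators in a polynomial over a residue field. -/
theorem MvPolynomial.exists_map_residueField_eq {A σ : Type*} [CommRing A] (p : Ideal A)
    [p.IsPrime] (b : MvPolynomial σ p.ResidueField) :
    ∃ a ∉ p, ∃ b' : MvPolynomial σ A, map (algebraMap A p.ResidueField) b' =
      C (algebraMap A p.ResidueField a) * b := by
  induction b using MvPolynomial.induction_on with
  | C c =>
    obtain ⟨u, v, hv, rfl⟩ := IsFractionRing.div_surjective (A := A ⧸ p) c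
    obtain ⟨u, rfl⟩ := Ideal.Quotient.mk_surjective u
    obtain ⟨v, rfl⟩ := Ideal.Quotient.mk_surjective v
    have hvp : v ∉ p := fun h =>
      nonZeroDivisors.ne_zero hv (Ideal.Quotient.eq_zero_iff_mem.2 h)
    refine ⟨v, hvp, C u, ?_⟩
    rw [map_C, ← C_mul]
    congr 1
    have h0 : algebraMap A p.ResidueField v ≠ 0 := by
      rwa [Ne, Ideal.algebraMap_residueField_eq_zero]
    exact (mul_div_cancel₀ _ h0).symm
  | add x y hx hy =>
    obtain ⟨a, ha, x', hx'⟩ := hx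
    obtain ⟨b, hb, y', hy'⟩ := hy
    refine ⟨a * b, Ideal.IsPrime.mul_notMem ‹_› ha hb, C b * x' + C a * y', ?_⟩
    rw [map_add, map_mul, map_mul, hx', hy', map_C, map_C, map_mul, C_mul]
    ring
  | mul_X x i hx =>
    obtain ⟨a, ha, x', hx'⟩ := hx
    exact ⟨a, ha, x' * X i, by rw [map_mul, hx', map_X, mul_assoc]⟩

theorem Ideal.exists_mem_map_residueField_eq {A σ : Type*} [CommRing A] (p : Ideal A)
    [p.IsPrime] (I : Ideal (MvPolynomial σ A)) {g : MvPolynomial σ p.ResidueField}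
    (hg : g ∈ I.map (MvPolynomial.map (algebraMap A p.ResidueField))) :
    ∃ a ∉ p, ∃ G ∈ I, MvPolynomial.map (algebraMap A p.ResidueField) G =
      C (algebraMap A p.ResidueField a) * g := by
  refine Submodule.span_induction (p := fun g _ => ∃ a ∉ p, ∃ G ∈ I,
    MvPolynomial.map (algebraMap A p.ResidueField) G =
      C (algebraMap A p.ResidueField a) * g) ?_ ?_ ?_ ?_ hg
  · rintro _ ⟨G, hG, rfl⟩
    exact ⟨1, (Ideal.ne_top_iff_one _).1 IsPrime.ne_top', G, hG, by simp⟩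
  · exact ⟨1, (Ideal.ne_top_iff_one _).1 IsPrime.ne_top', 0, I.zero_mem, by simp⟩
  · rintro x y - - ⟨a, ha, x', hx, hx'⟩ ⟨b, hb, y', hy, hy'⟩
    refine ⟨a * b, Ideal.IsPrime.mul_notMem ‹_› ha hb, C b * x' + C a * y',
      I.add_mem (I.mul_mem_left _ hx) (I.mul_mem_left _ hy), ?_⟩
    rw [map_add, map_mul, map_mul, hx', hy', map_C, map_C, map_mul, C_mul]
    ring
  · rintro c x - ⟨a, ha, x', hx, hx'⟩
    obtain ⟨b, hb, c', hc'⟩ := MvPolynomial.exists_map_residueField_eq p c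
    refine ⟨b * a, Ideal.IsPrime.mul_notMem ‹_› hb ha, c' * x', I.mul_mem_left _ hx, ?_⟩
    rw [map_mul, hx', hc', map_mul, C_mul, smul_eq_mul]
    ring

/-- Dependence of `S` spreads from `η` to a neighbourhood of `η` in its closure. The witness is a
polynomial `G ∈ I` whose coefficients at monomials outside `S` lie in `η`; the element `a` is a
coefficient of `G` that does not lie in `η`. -/
theorem Ideal.exists_notMem_forall_not_isIndependentSet {A σ : Type*} [CommRing A]
    (I : Ideal (MvPolynomial σ A)) (S : Set σ) {η : PrimeSpectrum A}
    (h : ¬ (I.map (MvPolynomial.map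
      (algebraMap A η.asIdeal.ResidueField))).IsIndependentSet S) :
    ∃ a ∉ η.asIdeal, ∀ q : PrimeSpectrum A, η ≤ q → a ∉ q.asIdeal →
      ¬ (I.map (MvPolynomial.map (algebraMap A q.asIdeal.ResidueField))).IsIndependentSet S := by
  simp only [Ideal.IsIndependentSet, not_forall] at h
  obtain ⟨g, hg, hgS, hg0⟩ := h
  obtain ⟨a, ha, G, hG, hGg⟩ := Ideal.exists_mem_map_residueField_eq _ I hg
  have hco (α : σ →₀ ℕ) : algebraMap A η.asIdeal.ResidueField (coeff α G) =
      algebraMap A η.asIdeal.ResidueField a * coeff α g := by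
    rw [← coeff_map, hGg, coeff_C_mul]
  obtain ⟨α, hα⟩ := ne_zero_iff.1 hg0
  refine ⟨coeff α G, ?_, fun q hq hqa hind => hqa ?_⟩
  · rw [← Ideal.algebraMap_residueField_eq_zero, hco]
    exact mul_ne_zero (by rwa [Ne, Ideal.algebraMap_residueField_eq_zero]) hα
  · have h0 := hind _ (Ideal.mem_map_of_mem _ hG) (mem_supported_iff_coeff.2 fun β hβ => by
      rw [coeff_map, Ideal.algebraMap_residueField_eq_zero]
      refine hq ?_
      rw [← Ideal.algebraMap_residueField_eq_zero, hco, mem_supported_iff_coeff.1 hgS β hβ,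
        mul_zero])
    rw [← Ideal.algebraMap_residueField_eq_zero, ← coeff_map, h0, coeff_zero]

/-! ### The tuple space -/

/-- The universal tuple of homogeneous polynomials of degrees `m_1, …, m_s`, with coefficients in
the coordinate ring of the affine space of tuples. -/
noncomputable def genericTuple (K : Type*) [Field K] {N s : ℕ} (m : Fin s → ℕ) (i : Fin s) :
    MvPolynomial (Fin (N + 1)) (MvPolynomial (CoeffIndex N m) K) :=
  ∑ e : DegreeExponent N (m i), monomial e.1 (X ⟨i, e⟩)

/-- The ideal generated by the `f_j` and the first `t` members of the universal tuple. -/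
noncomputable def genericIdeal {K : Type*} [Field K] {N r s : ℕ}
    (f : Fin r → MvPolynomial (Fin (N + 1)) K) (m : Fin s → ℕ) (t : ℕ) :
    Ideal (MvPolynomial (Fin (N + 1)) (MvPolynomial (CoeffIndex N m) K)) :=
  Ideal.span (Set.range (fun j => map C (f j)) ∪ genericTuple K m '' {i | (i : ℕ) < t})

theorem map_genericTuple {K : Type*} [Field K] {N s : ℕ} (m : Fin s → ℕ) (p : TupleSpace K N m)
    (i : Fin s) :
    map (algebraMap _ p.asIdeal.ResidueField) (genericTuple K m i) = tupleAt m p i := by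
  simp only [genericTuple, tupleAt, map_sum, map_monomial]

theorem map_genericIdeal {K : Type*} [Field K] {N r s : ℕ}
    (f : Fin r → MvPolynomial (Fin (N + 1)) K) (m : Fin s → ℕ) (p : TupleSpace K N m) (t : ℕ) :
    (genericIdeal f m t).map (map (algebraMap _ p.asIdeal.ResidueField)) =
      Ideal.span (Set.range (fun j => map (algebraMap K p.asIdeal.ResidueField) (f j)) ∪
        tupleAt m p '' {i | (i : ℕ) < t}) := by
  rw [genericIdeal, Ideal.map_span, Set.image_union, ← Set.range_comp, ← Set.image_comp]
  congr 3
  · funext j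
    simp only [Function.comp_apply, map_map]
    congr 2
  · funext i
    exact map_genericTuple m p i

theorem coeff_tupleAt {K : Type*} [Field K] {N s : ℕ} (m : Fin s → ℕ) (p : TupleSpace K N m)
    (i : Fin s) (α : Fin (N + 1) →₀ ℕ) :
    coeff α (tupleAt m p i) =
      if h : α ∈ Finset.finsuppAntidiag (Finset.univ : Finset (Fin (N + 1))) (m i) then
        algebraMap (MvPolynomial (CoeffIndex N m) K) p.asIdeal.ResidueField (X ⟨i, α, h⟩)
      else 0 := by
  classical
  simp only [tupleAt, coeff_sum, coeff_monomial]
  split_ifs with h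
  · rw [Finset.sum_eq_single ⟨α, h⟩]
    · simp
    · intro β _ hβ
      rw [if_neg fun h' => hβ (Subtype.ext h')]
    · simp
  · exact Finset.sum_eq_zero fun β _ => if_neg fun h' => by
      subst h'
      exact h β.2

/-- The coordinates that are coefficients of the `i`-th polynomial at monomials in the variables of
`S`. -/
def coeffIndexSupportedIn {N s : ℕ} (m : Fin s → ℕ) (i : Fin s) (S : Finset (Fin (N + 1))) :
    Finset (CoeffIndex N m) :=
  Finset.univ.filter fun x => x.1 = i ∧ x.2.1.support ⊆ S

theorem card_coeffIndexSupportedIn {N s : ℕ} (m : Fin s → ℕ) (i : Fin s)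
    (S : Finset (Fin (N + 1))) :
    (coeffIndexSupportedIn m i S).card = (S.card + m i - 1).choose (m i) := by
  rw [← Finset.card_finsuppAntidiag_nat_eq_choose]
  symm
  have hmem (α : Fin (N + 1) →₀ ℕ) (hα : α ∈ S.finsuppAntidiag (m i)) :
      α ∈ Finset.finsuppAntidiag (Finset.univ : Finset (Fin (N + 1))) (m i) :=
    Finset.finsuppAntidiag_mono (Finset.subset_univ S) _ hα
  refine Finset.card_bij (fun α hα => ⟨i, α, hmem α hα⟩) ?_ ?_ ?_
  · intro α hα
    simpa [coeffIndexSupportedIn] using (Finset.mem_finsuppAntidiag.1 hα).2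
  · intro α _ β _ h
    simpa using h
  · rintro ⟨j, α, hα⟩ hx
    simp only [coeffIndexSupportedIn, Finset.mem_filter, Finset.mem_univ, true_and] at hx
    obtain ⟨rfl, hx⟩ := hx
    refine ⟨α, ?_, rfl⟩
    rw [Finset.mem_finsuppAntidiag] at hα ⊢
    refine ⟨?_, hx⟩
    rw [← hα.1]
    exact Finset.sum_subset (Finset.subset_univ S) fun a _ ha =>
      Finsupp.notMem_support_iff.1 fun h => ha (hx h)

theorem card_coeffIndex (N : ℕ) {s : ℕ} (m : Fin s → ℕ) :
    Fintype.card (CoeffIndex N m) = ∑ i, (N + m i).choose N := by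
  rw [Fintype.card_sigma]
  refine Finset.sum_congr rfl fun i _ => ?_
  rw [Fintype.card_coe, Finset.card_finsuppAntidiag_nat_eq_choose, Finset.card_univ,
    Fintype.card_fin, Nat.choose_symm_of_eq_add (b := N)]
  · congr 1; omega
  · omega

theorem MvPolynomial.exists_map_eq_of_coeff_mem {k L σ : Type*} [Field k] [Field L] [Algebra k L]
    {p : MvPolynomial σ L} (h : ∀ α, coeff α p ∈ (algebraMap k L).range) :
    ∃ q, map (algebraMap k L) q = p := by
  have : p ∈ Set.range (map (σ := σ) (algebraMap k L)) := by
    rw [mem_range_map_iff_coeffs_subset]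
    intro c hc
    obtain ⟨α, -, rfl⟩ := mem_coeffs_iff.1 hc
    exact h α
  exact this

/-! ### The dimension bound -/

/-- The coefficients of the `i`-th polynomial at monomials in the variables of `S` are algebraic
over the field generated by all other coefficients, if `S` is independent modulo the first `i + 1`
polynomials of the tuple, but ceases to be independent modulo the first `i` when a variable is
added. -/
theorem trdeg_add_choose_le_of_minimal {K : Type*} [Field K] {N r s : ℕ}
    (f : Fin r → MvPolynomial (Fin (N + 1)) K) (m : Fin s → ℕ) (p : TupleSpace K N m) (i : Fin s)
    (S : Finset (Fin (N + 1)))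
    (hS : ((genericIdeal f m (i + 1)).map
      (map (algebraMap _ p.asIdeal.ResidueField))).IsIndependentSet (S : Set (Fin (N + 1))))
    (hdep : ∀ j ∉ S, ¬ ((genericIdeal f m i).map
      (map (algebraMap _ p.asIdeal.ResidueField))).IsIndependentSet
        (insert j (S : Set (Fin (N + 1))))) :
    (Algebra.trdeg K (MvPolynomial (CoeffIndex N m) K ⧸ p.asIdeal)).toNat +
      (S.card + m i - 1).choose (m i) ≤ ∑ i, (N + m i).choose N := by
  classical
  rw [← card_coeffIndexSupportedIn, ← card_coeffIndex]
  refine trdeg_quotient_add_card_le_of_isAlgebraic p.asIdeal _ ?_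
  set κ := p.asIdeal.ResidueField
  set c : CoeffIndex N m → κ :=
    fun x => algebraMap (MvPolynomial (CoeffIndex N m) K) κ (X x)
  set k := IntermediateField.adjoin K
    (c '' ((coeffIndexSupportedIn m i S)ᶜ : Finset (CoeffIndex N m)))
  have hck (x : CoeffIndex N m) (hx : x ∉ coeffIndexSupportedIn m i S) :
      c x ∈ (algebraMap k κ).range :=
    ⟨⟨c x, IntermediateField.subset_adjoin _ _ ⟨x, by simpa using hx, rfl⟩⟩, rfl⟩
  have hother (j : Fin s) (hj : j ≠ i) : ∃ q, map (algebraMap k κ) q = tupleAt m p j := by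
    refine exists_map_eq_of_coeff_mem fun α => ?_
    rw [coeff_tupleAt]
    split_ifs with h
    · exact hck _ fun hx => hj (Finset.mem_filter.1 hx).2.1
    · exact zero_mem _
  -- `g` is the part of the `i`-th polynomial in the variables of `S`.
  obtain ⟨g, hg⟩ : ∃ g : MvPolynomial (Fin (N + 1)) κ, ∀ α, coeff α g =
      if α.support ⊆ S then coeff α (tupleAt m p i) else 0 := by
    refine ⟨∑ α ∈ (tupleAt m p i).support with α.support ⊆ S,
      monomial α (coeff α (tupleAt m p i)), fun α => ?_⟩
    simp only [coeff_sum, coeff_monomial, Finset.sum_ite_eq', Finset.mem_filter, mem_support_iff]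
    by_cases h : coeff α (tupleAt m p i) = 0 <;> simp [h]
  have hgS : g ∈ supported κ (S : Set (Fin (N + 1))) := mem_supported_iff_coeff.2 fun α hα => by
    rw [hg, if_neg (by simpa using hα)]
  obtain ⟨h₀, hh₀⟩ : ∃ q, map (algebraMap k κ) q = tupleAt m p i - g := by
    refine exists_map_eq_of_coeff_mem fun α => ?_
    rw [coeff_sub, hg]
    split_ifs with h2
    · rw [sub_self]
      exact zero_mem _
    · rw [sub_zero, coeff_tupleAt]
      split_ifs with h1
      · exact hck _ fun hx => h2 (Finset.mem_filter.1 hx).2.2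
      · exact zero_mem _
  set J := (genericIdeal f m i).map (map (algebraMap _ κ)) with hJ
  -- `J` is defined over `k`, because none of its generators involves the `i`-th polynomial.
  let I : Ideal (MvPolynomial (Fin (N + 1)) k) := J.comap (map (algebraMap k κ))
  have hIJ : I.map (map (algebraMap k κ)) = J := by
    refine le_antisymm Ideal.map_comap_le ?_
    have hmem (q) (hq : map (algebraMap k κ) q ∈ J) :
        map (algebraMap k κ) q ∈ I.map (map (algebraMap k κ)) :=
      Ideal.mem_map_of_mem _ hq
    conv_lhs => rw [hJ, map_genericIdeal]
    have hle := hJ.trans (map_genericIdeal f m p i)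
    rw [Ideal.span_le]
    rintro _ (⟨j, rfl⟩ | ⟨j, hj, rfl⟩)
    · have h1 : map (algebraMap K κ) (f j) =
          map (algebraMap k κ) (map (algebraMap K k) (f j)) := by
        rw [map_map, ← IsScalarTower.algebraMap_eq]
      change map (algebraMap K κ) (f j) ∈ _
      rw [h1]
      refine hmem _ ?_
      rw [← h1, hle]
      exact Ideal.subset_span (Or.inl ⟨j, rfl⟩)
    · obtain ⟨q, hq⟩ := hother j (fun h => by simp [h] at hj)
      rw [SetLike.mem_coe, ← hq]
      refine hmem _ ?_
      rw [hq, hle]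
      exact Ideal.subset_span (Or.inr ⟨j, hj, rfl⟩)
  have halg : ∀ α, IsAlgebraic k (coeff α g) := by
    refine isAlgebraic_coeff_of_isIndependentSet (I := I) (h₀ := h₀) hgS (hS.mono ?_) ?_
    · rw [hIJ, hh₀, sub_add_cancel, sup_le_iff]
      constructor
      · refine Ideal.map_mono (Ideal.span_mono (Set.union_subset_union_right _
          (Set.image_mono fun j (hj : (j : ℕ) < i) => ?_)))
        exact Nat.lt_succ_of_lt hj
      · rw [Ideal.span_singleton_le_iff_mem, map_genericIdeal]
        exact Ideal.subset_span (Or.inr ⟨i, Nat.lt_succ_self _, rfl⟩)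
    · intro j hj h
      refine hdep j (by simpa using hj) ?_
      rw [← hIJ]
      exact (Ideal.isIndependentSet_map_iff κ I _).2 h
  rintro ⟨j, α, hα⟩ hx
  obtain ⟨-, rfl, hαS⟩ := Finset.mem_filter.1 hx
  have := halg α
  rwa [hg, if_pos hαS, coeff_tupleAt, dif_pos hα] at this

/-- The index at which the minimum is bounded is the first one at which the number of independent
variables is larger than expected. -/
theorem trdeg_add_iInf_choose_le {K : Type*} [Field K] {N n r s : ℕ} (hr : n + r = N)
    (f : Fin r → MvPolynomial (Fin (N + 1)) K)
    (hreg : RingTheory.Sequence.IsRegular (MvPolynomial (Fin (N + 1)) K) (List.ofFn f))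
    (hs : s ≤ n + 1) (m : Fin s → ℕ) (p : TupleSpace K N m) (S : Finset (Fin (N + 1)))
    (hcard : S.card + s = n + 2)
    (hS : ((genericIdeal f m s).map
      (map (algebraMap _ p.asIdeal.ResidueField))).IsIndependentSet (S : Set (Fin (N + 1)))) :
    (Algebra.trdeg K (MvPolynomial (CoeffIndex N m) K ⧸ p.asIdeal)).toNat +
      (⨅ i : Fin s, (n - (i : ℕ) + m i).choose (m i)) ≤ ∑ i, (N + m i).choose N := by
  classical
  let Q (t : ℕ) : Prop := ∃ S : Finset (Fin (N + 1)), S.card + t = n + 2 ∧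
    ((genericIdeal f m t).map
      (map (algebraMap _ p.asIdeal.ResidueField))).IsIndependentSet (S : Set (Fin (N + 1)))
  have hQ : ∃ t, Q t := ⟨s, S, hcard, hS⟩
  -- An independent set modulo the `f_j` has at most `N + 1 - r = n + 1` elements.
  have hQ0 : ¬ Q 0 := by
    rintro ⟨S, hScard, hS⟩
    have h1 : (genericIdeal f m 0).map (map (algebraMap _ p.asIdeal.ResidueField)) =
        (Ideal.span (Set.range f)).map (map (algebraMap K p.asIdeal.ResidueField)) := by
      rw [map_genericIdeal, Ideal.map_span, ← Set.range_comp]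
      simp [Function.comp_def]
    rw [h1, Ideal.isIndependentSet_map_iff] at hS
    have := card_add_le_of_isRegular hreg hS
    rw [Fintype.card_fin] at this
    omega
  have hle : Nat.find hQ ≤ s := Nat.find_min' hQ ⟨S, hcard, hS⟩
  obtain ⟨i, hi⟩ : ∃ i, Nat.find hQ = i + 1 :=
    Nat.exists_eq_succ_of_ne_zero fun h => hQ0 (h ▸ Nat.find_spec hQ)
  have hmin : ¬ Q i := Nat.find_min hQ (by omega)
  obtain ⟨S, hScard, hS⟩ := hi ▸ Nat.find_spec hQ
  have h1 := trdeg_add_choose_le_of_minimal f m p ⟨i, by omega⟩ S hS fun j hj hind =>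
    hmin ⟨insert j S, by rw [Finset.card_insert_of_notMem hj]; omega, by
      rwa [Finset.coe_insert]⟩
  have h2 : (⨅ i : Fin s, (n - (i : ℕ) + m i).choose (m i)) ≤
      (n - i + m ⟨i, by omega⟩).choose (m ⟨i, by omega⟩) :=
    ciInf_le (OrderBot.bddBelow _) (⟨i, by omega⟩ : Fin s)
  have h3 : S.card + m ⟨i, by omega⟩ - 1 = n - i + m ⟨i, by omega⟩ := by omega
  rw [h3] at h1
  exact (Nat.add_le_add_left h2 _).trans h1

theorem topologicalKrullDim_nonRegularVariety_add_iInf_le {K : Type*} [Field K] {N n r s : ℕ}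
    (hr : n + r = N) (f : Fin r → MvPolynomial (Fin (N + 1)) K)
    (hreg : RingTheory.Sequence.IsRegular (MvPolynomial (Fin (N + 1)) K) (List.ofFn f))
    (hs : s ≤ n + 1) (m : Fin s → ℕ) :
    topologicalKrullDim (nonRegularVariety n f m) +
        ((⨅ i : Fin s, (n - (i : ℕ) + m i).choose (m i) : ℕ) : WithBot ℕ∞) ≤
      ((∑ i : Fin s, (N + m i).choose N : ℕ) : WithBot ℕ∞) := by
  classical
  -- The independence condition defines a possibly larger locus `U`, which satisfies the same bound.
  let U : Set (TupleSpace K N m) := {p | ∃ S : Finset (Fin (N + 1)), S.card + s = n + 2 ∧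
    ((genericIdeal f m s).map
      (map (algebraMap _ p.asIdeal.ResidueField))).IsIndependentSet (S : Set (Fin (N + 1)))}
  have hsub : nonRegularVariety n f m ⊆ U := by
    intro p hp
    have h1 : ((n + 1 - s : ℕ) : WithBot ℕ∞) ≤ projDim (Set.range (fun j =>
        map (algebraMap K p.asIdeal.ResidueField) (f j)) ∪ Set.range (tupleAt m p)) := by
      have h2 := hp.2
      generalize projDim (Set.range (fun j => map (algebraMap K p.asIdeal.ResidueField) (f j)) ∪
        Set.range (tupleAt m p)) = D at h2 ⊢
      induction D with
      | bot => simp at h2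
      | coe D =>
        induction D with
        | top => exact le_top
        | coe D =>
          have h3 : n + 1 ≤ D + s := by exact_mod_cast h2
          have h4 : n + 1 - s ≤ D := by omega
          exact WithBot.coe_le_coe.2 (Nat.cast_le (α := ℕ∞).2 h4)
    obtain ⟨S, hS, hind⟩ := exists_isIndependentSet_of_le_projDim h1
    refine ⟨S, by omega, ?_⟩
    rw [map_genericIdeal]
    have : {i : Fin s | (i : ℕ) < s} = Set.univ := Set.eq_univ_of_forall fun i => i.2
    rwa [this, Set.image_univ]
  rcases (nonRegularVariety n f m).eq_empty_or_nonempty with h | ⟨p₀, hp₀⟩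
  · have : IsEmpty (nonRegularVariety n f m) := by rw [h]; infer_instance
    have hemp : topologicalKrullDim (nonRegularVariety n f m) = ⊥ :=
      Order.krullDim_eq_bot_iff.2 ⟨fun Z => isEmptyElim Z.isIrreducible.1.some⟩
    rw [hemp, WithBot.bot_add]
    exact bot_le
  set mn := ⨅ i : Fin s, (n - (i : ℕ) + m i).choose (m i)
  set total := ∑ i : Fin s, (N + m i).choose N
  have htr (p : TupleSpace K N m) (hp : p ∈ U) :
      (Algebra.trdeg K (MvPolynomial (CoeffIndex N m) K ⧸ p.asIdeal)).toNat + mn ≤ total := by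
    obtain ⟨S, hS, hind⟩ := hp
    exact trdeg_add_iInf_choose_le hr f hreg hs m p S hS hind
  have hU : ∀ η ∉ U, ∃ a ∉ η.asIdeal, ∀ q ∈ U, η ≤ q → a ∈ q.asIdeal := by
    intro η hη
    have h1 (S : Finset (Fin (N + 1))) : ∃ a ∉ η.asIdeal, S.card + s = n + 2 →
        ∀ q : TupleSpace K N m, η ≤ q → a ∉ q.asIdeal → ¬ ((genericIdeal f m s).map
          (map (algebraMap _ q.asIdeal.ResidueField))).IsIndependentSet
            (S : Set (Fin (N + 1))) := by
      by_cases hS : S.card + s = n + 2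
      · obtain ⟨a, ha, h⟩ := (genericIdeal f m s).exists_notMem_forall_not_isIndependentSet
          (S : Set (Fin (N + 1))) (η := η) fun h => hη ⟨S, hS, h⟩
        exact ⟨a, ha, fun _ => h⟩
      · exact ⟨1, (Ideal.ne_top_iff_one _).1 η.isPrime.ne_top, fun h => absurd h hS⟩
    choose a ha h using h1
    -- There are finitely many sets of variables, so the elements `a S` can be multiplied.
    refine ⟨∏ S, a S, fun hmem => ?_, ?_⟩
    · obtain ⟨S, -, hS⟩ := (Ideal.IsPrime.prod_mem_iff (hp := η.isPrime)).1 hmem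
      exact ha S hS
    · rintro q ⟨S, hS, hind⟩ hq
      have : a S ∈ q.asIdeal := by
        by_contra hc
        exact h S hS q hq hc hind
      exact Ideal.mem_of_dvd _ (Finset.dvd_prod_of_mem a (Finset.mem_univ S)) this
  have h1 : topologicalKrullDim (nonRegularVariety n f m) ≤ topologicalKrullDim U :=
    (Topology.IsEmbedding.inclusion hsub).isInducing.topologicalKrullDim_le
  have h2 : topologicalKrullDim U ≤ ((total - mn : ℕ) : WithBot ℕ∞) :=
    PrimeSpectrum.topologicalKrullDim_le_of_trdeg_le (K := K) hU fun p hp =>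
      Nat.le_sub_of_add_le (htr p hp)
  have h3 : mn ≤ total := (Nat.le_add_left _ _).trans (htr p₀ (hsub hp₀))
  calc _ ≤ ((total - mn : ℕ) : WithBot ℕ∞) + (mn : WithBot ℕ∞) :=
        add_le_add_left (h1.trans h2) _
    _ = (total : WithBot ℕ∞) := by
        norm_cast
        rw [Nat.sub_add_cancel h3]

end

theorem mainTheorem5 {K : Type*} [Field K] {N n r s : ℕ} (hr : n + r = N)
    (f : Fin r → MvPolynomial (Fin (N + 1)) K) (d : Fin r → ℕ)
    (hf : ∀ j, (f j).IsHomogeneous (d j))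
    (hreg : RingTheory.Sequence.IsRegular (MvPolynomial (Fin (N + 1)) K) (List.ofFn f))
    (hs : 1 ≤ s) (hsn : s ≤ n + 1)
    (m : Fin s → ℕ) (hm : ∀ i, 0 < m i) :
    topologicalKrullDim (nonRegularVariety n f m)
          + ((⨅ i : Fin s, (n - (i : ℕ) + m i).choose (m i) : ℕ) : WithBot ℕ∞)
        ≤ ((∑ i : Fin s, (N + m i).choose N : ℕ) : WithBot ℕ∞) ∧
      ∀ μ : ℕ, (∀ i, m i = μ) →
        topologicalKrullDim (nonRegularVariety n f m)
            + (((n + 1 - s + μ).choose μ : ℕ) : WithBot ℕ∞)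
          ≤ ((s * (N + μ).choose N : ℕ) : WithBot ℕ∞) := by
  have key := topologicalKrullDim_nonRegularVariety_add_iInf_le hr f hreg hsn m
  refine ⟨key, fun μ hμ => ?_⟩
  have : Nonempty (Fin s) := ⟨⟨0, hs⟩⟩
  have h1 : (n + 1 - s + μ).choose μ ≤ ⨅ i : Fin s, (n - (i : ℕ) + m i).choose (m i) :=
    le_ciInf fun i => by
      rw [hμ]
      exact Nat.choose_le_choose μ (by omega)
  have h2 : ∑ i : Fin s, (N + m i).choose N = s * (N + μ).choose N := by
    simp [hμ]
  rw [h2] at key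
  refine le_trans (add_le_add_right ?_ _) key
  exact_mod_cast h1
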